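/- Let $G=(V,E,W)$ be a finite connected weighted graph with positive edge weights, $W:E\to\mathbb R_{>0}$, and fix a total order on $V$. The weight of a path is the sum of the weights of its edges. For every pair of vertices $v,w$ let one path $p_{vw}=p_{wv}$ with the minimum number of edges be chosen (for instance the one that the unweighted Dijkstra algorithm finds from the smaller of the two vertices, ties being broken by the order on $V$). Define three distances on $V$ by $d_i(v,v)=0$ and, for $v\neq w$, - $d_1(v,w)$ is the weight of the chosen path $p_{vw}$; - $d_2(v,w)$ is the minimum weight of a path between $v$ and $w$; - $d_3(v,w)$ is the minimum weight among the paths between $v$ and $w$ that have the minimum number of edges. For a distance $d$ let $f_d(\sigma)=\max_{v,w\in\sigma}d(v,w)$ be the Vietoris–Rips filtration value of a simplex $\emptyset\ne\sigma\subseteq V$. Fix, once for all three distances, a total order of the simplices in which faces precede cofaces, and order the simplices as $\sigma_0,\sigma_1,\dots$ by $f_d$, simplices of equal value being ordered by this fixed order. Let $R$ be the matrix that the standard algorithm (left-to-right column reduction, over any fixed field) produces from the boundary matrix of this filtration, and let $\mathrm{low}_R(j)$ be the row index of the lowest nonzero entry of column $j$ of $R$ (undefined if the column is zero). Let $\mathsf{bcd}^{set}_1(d)$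 be the set of the bars $[f_d(\sigma_i),f_d(\sigma_j)]_{\sigma_i}$ where $\sigma_i$ is a $1$-simplex, $i=\mathrm{low}_R(j)$ and $f_d(\sigma_i)<f_d(\sigma_j)$, together with the bars $[f_d(\sigma_i),\infty]_{\sigma_i}$ where $\sigma_i$ is a $1$-simplex whose column in $R$ is zero and $i\neq\mathrm{low}_R(j)$ for all $j$. Then there are injections $\varphi_{2,3}:\mathsf{bcd}^{set}_1(d_2)\hookrightarrow\mathsf{bcd}^{set}_1(d_3)$ and $\varphi_{3,1}:\mathsf{bcd}^{set}_1(d_3)\hookrightarrow\mathsf{bcd}^{set}_1(d_1)$ that keep the birth simplex and the birth value and do not decrease the death value: $\varphi_{2,3}([a,b]_\sigma)=[a,c]_\sigma$ with $b\le c$ for every $[a,b]_\sigma\in\mathsf{bcd}^{set}_1(d_2)$, and $\varphi_{3,1}([a,c]_\sigma)=[a,d]_\sigma$ with $c\le d$ for every $[a,c]_\sigma\in\mathsf{bcd}^{set}_1(d_3)$. -/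

import Mathlib

/-! ### Path-based distances on a weighted graph -/

/-- The total weight of a walk: the sum of the weights of its edges. -/
def walkWeight {V : Type*} {G : SimpleGraph V} (W : Sym2 V → ℝ) {v w : V} (p : G.Walk v w) : ℝ :=
  (p.edges.map W).sum

/-- A choice, for every pair of vertices, of one path between them with the minimum number of
edges (the minimal edge path of the pair); the path does not depend on the order in which the two
vertices are named. -/
structure MinimalEdgePaths {V : Type*} (G : SimpleGraph V) where
  path : ∀ v w : V, G.Walk v w
  isPath : ∀ v w : V, (path v w).IsPath
  length_eq : ∀ v w : V, (path v w).length = G.dist v w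
  symm : ∀ v w : V, path w v = (path v w).reverse

/-- `d₁`: the weight of the minimal edge path. -/
noncomputable def minEdgeDist {V : Type*} [DecidableEq V] {G : SimpleGraph V}
    (P : MinimalEdgePaths G) (W : Sym2 V → ℝ) (v w : V) : ℝ :=
  if v = w then 0 else walkWeight W (P.path v w)

/-- `d₂`: the minimum of the weights of all paths (a minimum over a finite nonempty set when `G` is
finite and connected). -/
noncomputable def minWeightDist {V : Type*} [DecidableEq V] (G : SimpleGraph V)
    (W : Sym2 V → ℝ) (v w : V) : ℝ :=
  if v = w then 0 else ⨅ p : {p : G.Walk v w // p.IsPath}, walkWeight W p.1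

/-- `d₃`: the minimum of the weights of those paths that have the minimum number of edges. -/
noncomputable def hybridDist {V : Type*} [DecidableEq V] (G : SimpleGraph V)
    (W : Sym2 V → ℝ) (v w : V) : ℝ :=
  if v = w then 0 else
    ⨅ p : {p : G.Walk v w // p.IsPath ∧ p.length = G.dist v w}, walkWeight W p.1

/-! ### The minimal edge paths found by the unweighted Dijkstra algorithm

Vertices are settled in the order of (distance from the source, vertex label), so the predecessor
of `t` is the smallest neighbour of `t` that is one edge closer to the source. -/

theorem exists_predecessor {V : Type*} {G : SimpleGraph V} (hG : G.Connected) {s t : V} {n : ℕ}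
    (h : G.dist s t = n + 1) : ∃ u, G.Adj t u ∧ G.dist s u = n := by
  obtain ⟨p, hp⟩ := hG.exists_walk_length_eq_dist t s
  rw [SimpleGraph.dist_comm, h] at hp
  cases p with
  | nil => simp at hp
  | @cons _ u _ hadj q =>
    refine ⟨u, hadj, ?_⟩
    have h1 : q.length = n := by simpa using hp
    have h2 : G.dist s u ≤ n := by
      rw [SimpleGraph.dist_comm, ← h1]; exact SimpleGraph.dist_le q
    have h3 : G.dist s t ≤ G.dist s u + G.dist u t := hG.dist_triangle
    have h4 : G.dist u t = 1 := SimpleGraph.dist_eq_one_iff_adj.mpr hadj.symm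
    omega

open Classical in
/-- The predecessor of `t` in the search from `s`. -/
noncomputable def predecessor {V : Type*} [Fintype V] [LinearOrder V] {G : SimpleGraph V}
    (hG : G.Connected) {s t : V} {n : ℕ} (h : G.dist s t = n + 1) :
    {u : V // G.Adj t u ∧ G.dist s u = n} :=
  let c := Finset.univ.filter fun u => G.Adj t u ∧ G.dist s u = n
  have hc : c.Nonempty := (exists_predecessor hG h).imp fun u hu => by simpa [c] using hu
  ⟨c.min' hc, by simpa [c] using c.min'_mem hc⟩

/-- The walk from the source `s` to `t` that is read off from the predecessors. -/
noncomputable def dijkstraWalk {V : Type*} [Fintype V] [LinearOrder V] {G : SimpleGraph V}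
    (hG : G.Connected) (s : V) :
    ∀ (n : ℕ) (t : V), G.dist s t = n → {p : G.Walk s t // p.length = n}
  | 0, t, h => ⟨SimpleGraph.Walk.nil.copy rfl (hG.dist_eq_zero_iff.mp h), by simp⟩
  | n + 1, t, h =>
    let u := predecessor hG h
    let p := dijkstraWalk hG s n u.1 u.2.2
    ⟨p.1.concat u.2.1.symm, by simp [p.2]⟩

/-- The minimal edge paths found by the unweighted Dijkstra algorithm, run for each pair of
vertices from the smaller one. -/
noncomputable def dijkstraPaths {V : Type*} [Fintype V] [LinearOrder V] {G : SimpleGraph V}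
    (hG : G.Connected) : MinimalEdgePaths G :=
  have hlen : ∀ v w : V, (if v ≤ w then (dijkstraWalk hG v _ w rfl).1
      else (dijkstraWalk hG w _ v rfl).1.reverse).length = G.dist v w := fun v w => by
    split_ifs
    · exact (dijkstraWalk hG v _ w rfl).2
    · rw [SimpleGraph.Walk.length_reverse, (dijkstraWalk hG w _ v rfl).2, SimpleGraph.dist_comm]
  { path := fun v w => if v ≤ w then (dijkstraWalk hG v _ w rfl).1
      else (dijkstraWalk hG w _ v rfl).1.reverse
    isPath := fun v w => SimpleGraph.Walk.isPath_of_length_eq_dist _ (hlen v w)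
    length_eq := hlen
    symm := fun v w => by
      rcases lt_trichotomy v w with h | h | h
      · simp [h.le, not_le.mpr h]
      · subst h
        have h0 : (dijkstraWalk hG v _ v rfl).1.length = 0 := by
          rw [(dijkstraWalk hG v _ v rfl).2, SimpleGraph.dist_self]
        simp only [le_refl, if_true]
        generalize (dijkstraWalk hG v _ v rfl).1 = p at h0
        cases p with
        | nil => rfl
        | cons _ _ => simp at h0
      · simp [h.le, not_le.mpr h] }

/-! ### Vietoris–Rips filtrations -/

/-- The simplices on the vertex set `V`: its nonempty finite subsets. -/
abbrev Simplex (V : Type*) := {s : Finset V // s.Nonempty}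

/-- The Vietoris–Rips filtration value of a simplex with respect to `d`: the largest distance
between two of its vertices, which is the smallest `ε` for which the simplex lies in `VR(V, ε)`. -/
noncomputable def ripsValue {V : Type*} (d : V → V → ℝ) (s : Simplex V) : ℝ :=
  (s.1 ×ˢ s.1).sup' (s.2.product s.2) fun x => d x.1 x.2

/-- A total order of the simplices in which faces come before cofaces; it is used to order
simplices that enter a filtration at the same value. -/
structure TieBreak (V : Type*) where
  rank : Simplex V → ℕ
  injective : Function.Injective rank
  face_lt : ∀ s t : Simplex V, s.1 ⊂ t.1 → rank s < rank t

/-- The simplices are ordered by filtration value first and by the tie-break second. -/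
noncomputable def filtrationKey {V : Type*} (T : TieBreak V) (d : V → V → ℝ) (s : Simplex V) :
    ℝ ×ₗ ℕ :=
  toLex (ripsValue d s, T.rank s)

theorem filtrationKey_injective {V : Type*} (T : TieBreak V) (d : V → V → ℝ) :
    Function.Injective (filtrationKey T d) := fun _ _ h =>
  T.injective (congrArg Prod.snd (toLex.injective h))

/-- The enumeration of a finite type in the increasing order of an injective key. -/
noncomputable def enumByKey {α κ : Type*} [Fintype α] [LinearOrder κ] (key : α → κ)
    (h : Function.Injective key) : Fin (Fintype.card α) ≃ α :=
  letI : LinearOrder α := LinearOrder.lift' key h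
  (monoEquivOfFin α rfl).toEquiv

theorem enumByKey_lt_iff {α κ : Type*} [Fintype α] [LinearOrder κ] (key : α → κ)
    (h : Function.Injective key) (i j : Fin (Fintype.card α)) :
    key (enumByKey key h i) < key (enumByKey key h j) ↔ i < j :=
  letI : LinearOrder α := LinearOrder.lift' key h
  (monoEquivOfFin α rfl).lt_iff_lt (x := i) (y := j)

/-- The enumeration `σ₀, σ₁, …` of the simplices in the filtration order. -/
noncomputable def filtrationEnum {V : Type*} [Fintype V] [DecidableEq V] (T : TieBreak V)
    (d : V → V → ℝ) : Fin (Fintype.card (Simplex V)) ≃ Simplex V :=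
  enumByKey (filtrationKey T d) (filtrationKey_injective T d)

/-! ### Boundary matrix and standard reduction -/

/-- The coefficient of the simplex `s` in the boundary of the simplex `t = [x₀ ⋯ x_k]`,
`x₀ < ⋯ < x_k`, which is `∑ m, (-1) ^ m • [x₀ ⋯ x̂_m ⋯ x_k]`. -/
def boundaryCoeff (F : Type*) [Field F] {V : Type*} [LinearOrder V] (s t : Simplex V) : F :=
  ∑ v ∈ t.1, if t.1.erase v = s.1 then (-1) ^ (t.1.filter (· < v)).card else 0

/-- The boundary matrix of the Vietoris–Rips filtration, rows and columns in filtration order. -/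
noncomputable def boundaryMatrix (F : Type*) [Field F] {V : Type*} [Fintype V] [LinearOrder V]
    (T : TieBreak V) (d : V → V → ℝ) :
    Matrix (Fin (Fintype.card (Simplex V))) (Fin (Fintype.card (Simplex V))) F :=
  fun i j => boundaryCoeff F (filtrationEnum T d i) (filtrationEnum T d j)

open Classical in
/-- `low M j`: the row index of the lowest nonzero entry of column `j`, and `⊥` if the column is
zero. -/
noncomputable def low {F : Type*} [Field F] {n : ℕ} (M : Matrix (Fin n) (Fin n) F) (j : Fin n) :
    WithBot (Fin n) :=
  (Finset.univ.filter fun i => M i j ≠ 0).max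

open Classical in
/-- One pass of the inner loop of the standard algorithm: if some column `k` to the left of `j` has
the same lowest nonzero row `i` as column `j`, subtract the multiple of column `k` from column `j`
that clears the entry `(i, j)`; otherwise do nothing. -/
noncomputable def reduceStep {F : Type*} [Field F] {n : ℕ} (j : Fin n)
    (M : Matrix (Fin n) (Fin n) F) : Matrix (Fin n) (Fin n) F :=
  if h : ∃ x : Fin n × Fin n, x.1 < j ∧ low M x.1 = (x.2 : WithBot (Fin n)) ∧
      low M j = (x.2 : WithBot (Fin n)) then
    let k := h.choose.1
    let i := h.choose.2
    M.updateCol j fun r => M r j - M i j / M i k * M r k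
  else M

/-- The inner loop for column `j`. Each effective pass moves the lowest nonzero entry of column `j`
up, so after `n` passes the loop has come to its end. -/
noncomputable def reduceColumn {F : Type*} [Field F] {n : ℕ} (M : Matrix (Fin n) (Fin n) F)
    (j : Fin n) : Matrix (Fin n) (Fin n) F :=
  (reduceStep j)^[n] M

/-- The standard algorithm: the columns are reduced one after the other, from left to right. -/
noncomputable def standardReduction {F : Type*} [Field F] {n : ℕ} (M : Matrix (Fin n) (Fin n) F) :
    Matrix (Fin n) (Fin n) F :=
  (List.finRange n).foldl reduceColumn M

/-! ### Barcodes -/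

/-- A bar `[birth, death]` tagged by its birth simplex. -/
structure Bar (V : Type*) where
  birth : ℝ
  death : WithTop ℝ
  simplex : Simplex V

/-- The `p`-dimensional Vietoris–Rips barcode of `d` with coefficients in `F`, each bar tagged by
its birth simplex. With `R` the reduced boundary matrix, there is a finite bar for each pair
`i = low R j` with `σᵢ` of dimension `p` and of smaller filtration value than `σⱼ`, and an infinite
bar for each `p`-simplex `σᵢ` whose column in `R` is zero and which is not `low R j` for any `j`. -/
def barcodeSet (F : Type*) [Field F] {V : Type*} [Fintype V] [LinearOrder V] (T : TieBreak V)
    (p : ℕ) (d : V → V → ℝ) : Set (Bar V) :=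
  let σ := filtrationEnum T d
  let R := standardReduction (boundaryMatrix F T d)
  {B | ∃ i j, (σ i).1.card = p + 1 ∧ low R j = (i : WithBot (Fin _)) ∧
      ripsValue d (σ i) < ripsValue d (σ j) ∧
      B = ⟨ripsValue d (σ i), (ripsValue d (σ j) : WithTop ℝ), σ i⟩} ∪
  {B | ∃ i, (σ i).1.card = p + 1 ∧ low R i = ⊥ ∧ (∀ j, low R j ≠ (i : WithBot (Fin _))) ∧
      B = ⟨ripsValue d (σ i), ⊤, σ i⟩}

/-! ### The standard reduction -/

section Reduction

variable {F : Type*} [Field F] {n : ℕ}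

/-! Each of the pairs (`d₂`, `d₃`) and (`d₃`, `d₁`) satisfies `Refines d d'`: `d ≤ d'`, and if they
differ at an edge `vw`, some third vertex `u` has `d v u` and `d u w` below `d v w`. To see this,
take `u` to be the second vertex of an optimal path for `d`; if that path is a single edge, both
distances equal its weight. The rest uses only `Refines`.

Let `vw` carry a bar for `d`. If `d'` differed from `d` at `vw`, the triangle `uvw` would have the
same value as `vw`, which is its last face, so `vw` would be killed at its own value and have no bar
(`exists_low_eq_of_triangle`). Hence the birth value is the same for `d'`.

If `vw` is killed for `d'` by a chain, the same chain works for `d`: since `d ≤ d'` with equality at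
`vw`, no simplex moves from before `vw` to after it, and no value grows. So the death for `d` is not
later (`Refines.exists_low_eq`). If `vw` is never killed for `d'`, an infinite bar requires that its
column be zero there too. For an edge this says that its end points are joined by earlier edges
(`low_eq_bot_iff_joinedBelow`), a property that passes from `d` to `d'` by detours through the
vertices `u` (`Refines.joinedBelow`).

The algebraic input is a description of the lowest entries of the reduced matrix by chains,
independent of the algorithm's choices. It holds because the reduction is an invertible triangular
column operation with pairwise distinct lowest entries. Since a bar is determined by its birth
simplex, keeping that simplex makes the map injective. -/

theorem low_eq_coe_iff {M : Matrix (Fin n) (Fin n) F} {i j : Fin n} :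
    low M j = (i : WithBot (Fin n)) ↔ M i j ≠ 0 ∧ ∀ r, M r j ≠ 0 → r ≤ i := by
  classical
  unfold low
  constructor
  · intro h
    have h1 := Finset.mem_of_max h
    refine ⟨by simpa using h1, fun r hr => ?_⟩
    exact Finset.le_max_of_eq (by simpa using hr) h
  · rintro ⟨h1, h2⟩
    refine le_antisymm (Finset.max_le fun r hr => ?_) (Finset.le_max (by simpa using h1))
    exact WithBot.coe_le_coe.mpr (h2 r (by simpa using hr))

theorem low_eq_bot_iff {M : Matrix (Fin n) (Fin n) F} {j : Fin n} :
    low M j = ⊥ ↔ ∀ r, M r j = 0 := by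
  classical
  unfold low
  rw [Finset.max_eq_bot, Finset.filter_eq_empty_iff]
  simp

theorem low_congr {M N : Matrix (Fin n) (Fin n) F} {j : Fin n} (h : ∀ r, M r j = N r j) :
    low M j = low N j := by
  classical
  simp only [low, h]

/-- `N` arises from `M` by an invertible upper triangular column operation. -/
def ColumnEquiv (M N : Matrix (Fin n) (Fin n) F) : Prop :=
  ∃ U U' : Matrix (Fin n) (Fin n) F, U.BlockTriangular id ∧ U'.BlockTriangular id ∧
    U * U' = 1 ∧ N = M * U

theorem ColumnEquiv.refl (M : Matrix (Fin n) (Fin n) F) : ColumnEquiv M M :=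
  ⟨1, 1, Matrix.blockTriangular_one, Matrix.blockTriangular_one, by simp, by simp⟩

theorem ColumnEquiv.trans {M N L : Matrix (Fin n) (Fin n) F} (h : ColumnEquiv M N)
    (h' : ColumnEquiv N L) : ColumnEquiv M L := by
  obtain ⟨U, U', hU, hU', h1, rfl⟩ := h
  obtain ⟨Y, Y', hY, hY', h2, rfl⟩ := h'
  refine ⟨U * Y, Y' * U', hU.mul hY, hY'.mul hU', ?_, Matrix.mul_assoc _ _ _⟩
  rw [Matrix.mul_assoc, ← Matrix.mul_assoc Y, h2, Matrix.one_mul, h1]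

theorem columnEquiv_transvection (M : Matrix (Fin n) (Fin n) F) {k j : Fin n} (hkj : k < j)
    (a : F) : ColumnEquiv M (M * Matrix.transvection k j a) := by
  have tri : ∀ b : F, (Matrix.transvection k j b).BlockTriangular id := fun b =>
    Matrix.blockTriangular_transvection hkj.le b
  refine ⟨_, Matrix.transvection k j (-a), tri a, tri (-a), ?_, rfl⟩
  rw [Matrix.transvection_mul_transvection_same _ _ hkj.ne]
  simp

theorem reduceStep_apply_of_ne {M : Matrix (Fin n) (Fin n) F} {j k : Fin n} (h : k ≠ j)
    (r : Fin n) : reduceStep j M r k = M r k := by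
  unfold reduceStep
  split_ifs
  · simp [Matrix.updateCol_ne h]
  · rfl

/-- A pair `(k, i)` such that column `k` can be used to clear the lowest entry of column `j`. -/
def IsPivotFor (M : Matrix (Fin n) (Fin n) F) (j : Fin n) (x : Fin n × Fin n) : Prop :=
  x.1 < j ∧ low M x.1 = (x.2 : WithBot (Fin n)) ∧ low M j = (x.2 : WithBot (Fin n))

theorem reduceStep_of_not_exists {M : Matrix (Fin n) (Fin n) F} {j : Fin n}
    (h : ¬ ∃ x, IsPivotFor M j x) : reduceStep j M = M :=
  dif_neg h

theorem reduceStep_of_exists {M : Matrix (Fin n) (Fin n) F} {j : Fin n}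
    (h : ∃ x, IsPivotFor M j x) : ∃ x, IsPivotFor M j x ∧
      reduceStep j M = M.updateCol j fun r => M r j - M x.2 j / M x.2 x.1 * M r x.1 :=
  ⟨h.choose, h.choose_spec, dif_pos h⟩

theorem columnEquiv_reduceStep (M : Matrix (Fin n) (Fin n) F) (j : Fin n) :
    ColumnEquiv M (reduceStep j M) := by
  by_cases h : ∃ x, IsPivotFor M j x
  · obtain ⟨x, hx, e⟩ := reduceStep_of_exists h
    have key : reduceStep j M = M * Matrix.transvection x.1 j (-(M x.2 j / M x.2 x.1)) := by
      rw [e]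
      ext r c
      by_cases hc : c = j
      · subst hc
        rw [Matrix.updateCol_self, Matrix.mul_transvection_apply_same]
        ring
      · rw [Matrix.updateCol_ne hc, Matrix.mul_transvection_apply_of_ne _ _ _ _ hc]
    rw [key]
    exact columnEquiv_transvection M hx.1 _
  · rw [reduceStep_of_not_exists h]
    exact .refl M

theorem columnEquiv_reduceColumn (M : Matrix (Fin n) (Fin n) F) (j : Fin n) :
    ColumnEquiv M (reduceColumn M j) := by
  suffices h : ∀ m, ColumnEquiv M ((reduceStep j)^[m] M) from h n
  intro m
  induction m with
  | zero => exact .refl M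
  | succ m ih =>
    rw [Function.iterate_succ_apply']
    exact ih.trans (columnEquiv_reduceStep _ _)

theorem columnEquiv_standardReduction (M : Matrix (Fin n) (Fin n) F) :
    ColumnEquiv M (standardReduction M) := by
  unfold standardReduction
  generalize List.finRange n = l
  induction l generalizing M with
  | nil => exact .refl M
  | cons a l ih => exact (columnEquiv_reduceColumn M a).trans (ih _)

/-! ### Termination of the column loop and distinctness of the lowest entries -/

theorem reduceColumn_apply_of_ne {M : Matrix (Fin n) (Fin n) F} {j k : Fin n} (h : k ≠ j)
    (r : Fin n) : reduceColumn M j r k = M r k := by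
  suffices h : ∀ m, (reduceStep j)^[m] M r k = M r k from h n
  intro m
  induction m with
  | zero => rfl
  | succ m ih => rw [Function.iterate_succ_apply', reduceStep_apply_of_ne h, ih]

/-- Both columns vanish below the pivot row and the pivot itself cancels, so the zero tail of column
`j` grows by a row. The bounds `m < r + 1` and `m < r + 2` mean `r ≥ m` and `r ≥ m - 1` without
truncated subtraction. -/
theorem reduceStep_apply_eq_zero {M : Matrix (Fin n) (Fin n) F} {j : Fin n}
    (h : ∃ x, IsPivotFor M j x) {m : ℕ} (hm : ∀ r : Fin n, m < r.val + 1 → M r j = 0)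
    (r : Fin n) (hr : m < r.val + 2) : reduceStep j M r j = 0 := by
  obtain ⟨x, ⟨-, h1, h2⟩, e⟩ := reduceStep_of_exists h
  rw [low_eq_coe_iff] at h1 h2
  rw [e, Matrix.updateCol_self]
  have hx : x.2.val + 1 ≤ m := by
    by_contra hlt
    exact h2.1 (hm _ (by omega))
  by_cases hrx : r = x.2
  · rw [hrx, div_mul_cancel₀ _ h1.1, sub_self]
  · have hlt : ¬ r ≤ x.2 := fun hle => by
      have : r < x.2 := lt_of_le_of_ne hle hrx
      omega
    rw [not_imp_comm.mp (h1.2 r) hlt, not_imp_comm.mp (h2.2 r) hlt]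
    simp

theorem not_exists_isPivotFor_reduceColumn (M : Matrix (Fin n) (Fin n) F) (j : Fin n) :
    ¬ ∃ x, IsPivotFor (reduceColumn M j) j x := by
  -- After `m` passes the loop is stuck or the last `m` rows of the column are zero; for `m = n` the
  -- second case leaves a zero column, which has no pivot.
  have key : ∀ m : ℕ, m ≤ n → (¬ ∃ x, IsPivotFor ((reduceStep j)^[m] M) j x) ∨
      ∀ r : Fin n, n - m < r.val + 1 → (reduceStep j)^[m] M r j = 0 := by
    intro m
    induction m with
    | zero => exact fun _ => Or.inr fun r hr => by omega
    | succ m ih =>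
      intro hm
      rw [Function.iterate_succ_apply']
      by_cases h : ∃ x, IsPivotFor ((reduceStep j)^[m] M) j x
      · have h0 := (ih (by omega)).resolve_left (not_not.mpr h)
        exact Or.inr fun r hr => reduceStep_apply_eq_zero h h0 r (by omega)
      · rw [reduceStep_of_not_exists h]
        exact Or.inl h
  rcases key n le_rfl with h | h
  · exact h
  · rintro ⟨x, -, -, h2⟩
    exact (low_eq_coe_iff.mp h2).1 (h _ (by omega))

theorem low_standardReduction_injective (M : Matrix (Fin n) (Fin n) F) {i j k : Fin n}
    (hj : low (standardReduction M) j = (i : WithBot (Fin n)))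
    (hk : low (standardReduction M) k = (i : WithBot (Fin n))) : j = k := by
  -- Columns are processed in increasing order, so reducing a later column `a` changes neither a
  -- finished column nor any column to its left.
  have main : ∀ l : List (Fin n), l.Pairwise (· < ·) → ∀ j ∈ l,
      ¬ ∃ x, IsPivotFor (l.foldl reduceColumn M) j x := by
    intro l
    induction l using List.reverseRecOn with
    | nil => simp
    | append_singleton l a ih =>
      intro hl j hj
      rw [List.pairwise_append] at hl
      rw [List.foldl_append, List.foldl_cons, List.foldl_nil]
      rcases List.mem_append.mp hj with h | h
      · have hja : j < a := hl.2.2 j h a (by simp)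
        rintro ⟨x, h1, h2, h3⟩
        refine ih hl.1 j h ⟨x, h1, ?_, ?_⟩
        · rwa [low_congr fun r => (reduceColumn_apply_of_ne (h1.trans hja).ne r).symm]
        · rwa [low_congr fun r => (reduceColumn_apply_of_ne hja.ne r).symm]
      · rw [List.mem_singleton.mp h]
        exact not_exists_isPivotFor_reduceColumn _ _
  have hred : ∀ j, ¬ ∃ x, IsPivotFor (standardReduction M) j x := fun j =>
    main _ (List.pairwise_lt_finRange n) j (List.mem_finRange j)
  rcases lt_trichotomy j k with h | h | h
  · exact absurd ⟨(j, i), h, hj, hk⟩ (hred k)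
  · exact h
  · exact absurd ⟨(k, i), h, hk, hj⟩ (hred j)

/-! ### Lowest entries of the reduced matrix in terms of vectors -/

theorem exists_of_mulVec_ne_zero {M : Matrix (Fin n) (Fin n) F} {c : Fin n → F} {r : Fin n}
    (h : M.mulVec c r ≠ 0) : ∃ l, M r l ≠ 0 ∧ c l ≠ 0 := by
  obtain ⟨l, -, hl⟩ := Finset.exists_ne_zero_of_sum_ne_zero (s := Finset.univ)
    (f := fun l => M r l * c l) h
  exact ⟨l, left_ne_zero_of_mul hl, right_ne_zero_of_mul hl⟩

/-- The lowest nonzero entry of a combination of columns with distinct lowest entries is the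
maximum of the lowest entries of the columns. -/
theorem mulVec_of_low_injective {R : Matrix (Fin n) (Fin n) F}
    (hR : ∀ i j k : Fin n, low R j = (i : WithBot (Fin n)) → low R k = (i : WithBot (Fin n)) →
      j = k) (c : Fin n → F) :
    (∀ k, c k ≠ 0 → low R k = ⊥) ∨ ∃ k i : Fin n, c k ≠ 0 ∧ low R k = (i : WithBot (Fin n)) ∧
      R.mulVec c i ≠ 0 ∧ ∀ r, R.mulVec c r ≠ 0 → r ≤ i := by
  classical
  by_cases hall : ∀ k, c k ≠ 0 → low R k = ⊥
  · exact Or.inl hall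
  right
  push Not at hall
  obtain ⟨k₀, hk₀, hlow₀⟩ := hall
  -- Among the columns that occur, take one whose lowest entry is furthest down; since lowest
  -- entries are distinct, no other column can cancel it.
  obtain ⟨k, hk, hmax⟩ := Finset.exists_max_image (Finset.univ.filter fun k => c k ≠ 0) (low R)
    ⟨k₀, by simpa using hk₀⟩
  simp only [Finset.mem_filter, Finset.mem_univ, true_and] at hk hmax
  have hne : low R k ≠ ⊥ := fun h => hlow₀ (le_bot_iff.mp (h ▸ hmax k₀ hk₀))
  obtain ⟨i, hi⟩ := WithBot.ne_bot_iff_exists.mp hne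
  have hzero : ∀ l r, c l ≠ 0 → R r l ≠ 0 → (r : WithBot (Fin n)) ≤ (i : WithBot (Fin n)) := fun l r hl hr => by
    refine le_trans ?_ ((hmax l hl).trans hi.symm.le)
    exact Finset.le_max (by simpa using hr)
  refine ⟨k, i, hk, hi.symm, ?_, fun r hr => ?_⟩
  · have hsum : R.mulVec c i = R i k * c k := by
      refine Finset.sum_eq_single k (fun l _ hlk => ?_) fun h => absurd (Finset.mem_univ k) h
      by_contra hne
      have hc : c l ≠ 0 := right_ne_zero_of_mul hne
      have hr : R i l ≠ 0 := left_ne_zero_of_mul hne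
      refine hlk (hR i l k (low_eq_coe_iff.mpr ⟨hr, fun r hr => ?_⟩) hi.symm)
      exact WithBot.coe_le_coe.mp (hzero l r hc hr)
    rw [hsum]
    exact mul_ne_zero (low_eq_coe_iff.mp hi.symm).1 hk
  · obtain ⟨l, hl⟩ := exists_of_mulVec_ne_zero hr
    exact WithBot.coe_le_coe.mp (hzero l r hl.2 hl.1)

theorem Matrix.BlockTriangular.exists_le_of_mulVec_ne_zero {U : Matrix (Fin n) (Fin n) F}
    (hU : U.BlockTriangular id) {c : Fin n → F} {k : Fin n} (h : U.mulVec c k ≠ 0) :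
    ∃ l, c l ≠ 0 ∧ k ≤ l := by
  obtain ⟨l, hl, hc⟩ := exists_of_mulVec_ne_zero h
  exact ⟨l, hc, not_lt.mp fun hlt => hl (hU hlt)⟩

theorem mulVec_apply_self_of_blockTriangular {U : Matrix (Fin n) (Fin n) F}
    (hU : U.BlockTriangular id) {c : Fin n → F} {i : Fin n} (hc : ∀ l, c l ≠ 0 → l ≤ i) :
    U.mulVec c i = U i i * c i := by
  refine Finset.sum_eq_single i (fun l _ hl => ?_) fun h => absurd (Finset.mem_univ i) h
  by_contra hne
  have h1 : l ≤ i := hc l (right_ne_zero_of_mul hne)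
  exact left_ne_zero_of_mul hne (hU (lt_of_le_of_ne h1 hl))

/-- This makes the diagonal entries nonzero, so the triangular change of coordinates keeps the last
index of a vector. -/
theorem diag_mul_diag_of_blockTriangular {U U' : Matrix (Fin n) (Fin n) F}
    (hU : U.BlockTriangular id) (hU' : U'.BlockTriangular id) (h : U * U' = 1) (i : Fin n) :
    U i i * U' i i = 1 := by
  have h1 : (U * U') i i = U.mulVec (fun l => U' l i) i := rfl
  rw [← mulVec_apply_self_of_blockTriangular hU (c := fun l => U' l i), ← h1, h,
    Matrix.one_apply_eq]
  exact fun l hl => not_lt.mp fun hlt => hl (hU' hlt)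

/-- A column of the reduced matrix is zero exactly when there is a cycle that ends with it. -/
theorem low_standardReduction_eq_bot_iff (M : Matrix (Fin n) (Fin n) F) (i : Fin n) :
    low (standardReduction M) i = ⊥ ↔
      ∃ c : Fin n → F, c i ≠ 0 ∧ (∀ l, c l ≠ 0 → l ≤ i) ∧ M.mulVec c = 0 := by
  obtain ⟨U, U', hU, hU', h1, h2⟩ := columnEquiv_standardReduction M
  have hdiag := diag_mul_diag_of_blockTriangular hU hU' h1 i
  constructor
  · intro h
    refine ⟨fun l => U l i, left_ne_zero_of_mul_eq_one hdiag,
      fun l hl => not_lt.mp fun hlt => hl (hU hlt), ?_⟩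
    ext r
    have h3 := low_eq_bot_iff.mp h r
    rw [h2] at h3
    exact h3
  · rintro ⟨c, hci, hc, hMc⟩
    -- In the reduced coordinates `U' c` the cycle can only involve zero columns, and index `i`
    -- still occurs in it.
    have h3 : (standardReduction M).mulVec (U'.mulVec c) = 0 := by
      rw [h2, Matrix.mulVec_mulVec, Matrix.mul_assoc, h1, Matrix.mul_one, hMc]
    rcases mulVec_of_low_injective (fun i j k => low_standardReduction_injective M (i := i))
      (U'.mulVec c) with h | ⟨k, r, -, -, h, -⟩
    · refine h i ?_
      rw [mulVec_apply_self_of_blockTriangular hU' hc]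
      exact mul_ne_zero (right_ne_zero_of_mul_eq_one hdiag) hci
    · rw [h3] at h
      exact absurd rfl h

/-- The lowest entry of a boundary is the lowest entry of a reduced column that is not to the right
of the chain. -/
theorem exists_low_standardReduction_eq (M : Matrix (Fin n) (Fin n) F) {i : Fin n}
    {c : Fin n → F} (hi : M.mulVec c i ≠ 0) (hc : ∀ r, M.mulVec c r ≠ 0 → r ≤ i) :
    ∃ j l : Fin n, low (standardReduction M) j = (i : WithBot (Fin n)) ∧ c l ≠ 0 ∧ j ≤ l := by
  obtain ⟨U, U', hU, hU', h1, h2⟩ := columnEquiv_standardReduction M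
  have h3 : (standardReduction M).mulVec (U'.mulVec c) = M.mulVec c := by
    rw [h2, Matrix.mulVec_mulVec, Matrix.mul_assoc, h1, Matrix.mul_one]
  rcases mulVec_of_low_injective (fun i j k => low_standardReduction_injective M (i := i))
      (U'.mulVec c) with h | ⟨k, r, hk, hlow, hr, hmax⟩
  · refine absurd ?_ hi
    rw [← h3]
    by_contra hne
    obtain ⟨k, hk, hck⟩ := exists_of_mulVec_ne_zero hne
    exact hk (low_eq_bot_iff.mp (h k hck) i)
  · rw [h3] at hr hmax
    -- Both rows are the lowest nonzero row of `M c`; triangularity of `U'` then bounds the column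
    -- `k` by an index in the support of `c`.
    obtain rfl : r = i := le_antisymm (hc r hr) (hmax i hi)
    obtain ⟨l, hl, hkl⟩ := hU'.exists_le_of_mulVec_ne_zero hk
    exact ⟨k, l, hlow, hl, hkl⟩

/-- A lowest entry of the reduced matrix is the lowest entry of the boundary of a chain. -/
theorem exists_chain_of_low_standardReduction_eq (M : Matrix (Fin n) (Fin n) F) {i j : Fin n}
    (h : low (standardReduction M) j = (i : WithBot (Fin n))) :
    ∃ c : Fin n → F, (∀ l, c l ≠ 0 → l ≤ j) ∧ M.mulVec c i ≠ 0 ∧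
      ∀ r, M.mulVec c r ≠ 0 → r ≤ i := by
  obtain ⟨U, U', hU, -, -, h2⟩ := columnEquiv_standardReduction M
  have h3 : ∀ r, standardReduction M r j = M.mulVec (fun l => U l j) r := fun r => by
    rw [h2]
    rfl
  obtain ⟨h4, h5⟩ := low_eq_coe_iff.mp h
  simp only [h3] at h4 h5
  exact ⟨fun l => U l j, fun l hl => not_lt.mp fun hlt => hl (hU hlt), h4, h5⟩

end Reduction

/-! ### Chains and the boundary operator -/

section Chains

variable {F : Type*} [Field F] {V : Type*} [LinearOrder V]

theorem exists_of_boundaryCoeff_ne_zero {s t : Simplex V} (h : boundaryCoeff F s t ≠ 0) :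
    ∃ v ∈ t.1, t.1.erase v = s.1 := by
  obtain ⟨v, hv, hne⟩ := Finset.exists_ne_zero_of_sum_ne_zero h
  exact ⟨v, hv, by_contra fun hs => hne (if_neg hs)⟩

theorem card_of_boundaryCoeff_ne_zero {s t : Simplex V} (h : boundaryCoeff F s t ≠ 0) :
    t.1.card = s.1.card + 1 := by
  obtain ⟨v, hv, hs⟩ := exists_of_boundaryCoeff_ne_zero h
  rw [← hs, Finset.card_erase_add_one hv]

theorem boundaryCoeff_erase {s t : Simplex V} {v : V} (hv : v ∈ t.1) (hs : t.1.erase v = s.1) :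
    boundaryCoeff F s t = (-1) ^ (t.1.filter (· < v)).card := by
  rw [boundaryCoeff, Finset.sum_eq_single_of_mem v hv, if_pos hs]
  intro w hw hwv
  refine if_neg fun hs' => ?_
  have h1 : w ∈ t.1.erase v := Finset.mem_erase.mpr ⟨hwv, hw⟩
  rw [hs, ← hs'] at h1
  exact Finset.notMem_erase w _ h1

theorem boundaryCoeff_erase_ne_zero {s t : Simplex V} {v : V} (hv : v ∈ t.1)
    (hs : t.1.erase v = s.1) : boundaryCoeff F s t ≠ 0 := by
  rw [boundaryCoeff_erase hv hs]
  exact pow_ne_zero _ (neg_ne_zero.mpr one_ne_zero)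

theorem card_filter_erase_of_lt {t : Finset V} {x y : V} (hxy : x < y) :
    ((t.erase y).filter (· < x)).card = (t.filter (· < x)).card := by
  congr 1
  ext z
  simp only [Finset.mem_filter, Finset.mem_erase]
  exact ⟨fun h => ⟨h.1.2, h.2⟩, fun h => ⟨⟨(h.2.trans hxy).ne, h.1⟩, h.2⟩⟩

theorem card_filter_erase_add_one {t : Finset V} {x y : V} (hx : x ∈ t) (hxy : x < y) :
    ((t.erase x).filter (· < y)).card + 1 = (t.filter (· < y)).card := by
  rw [Finset.filter_erase, Finset.card_erase_add_one (Finset.mem_filter.mpr ⟨hx, hxy⟩)]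

variable [Fintype V]

/-- The boundary of a chain. -/
def chainBoundary (c : Simplex V → F) (s : Simplex V) : F :=
  ∑ t, boundaryCoeff F s t * c t

/-- A nonzero term means that `r` is `t` without two vertices `x < y`, which can be deleted in
either order. Deleting `x` first lowers the position of `y` by one, while deleting `y` first leaves
that of `x` alone, so the two terms cancel. -/
theorem sum_boundaryCoeff_mul_boundaryCoeff (r t : Simplex V) :
    ∑ s, boundaryCoeff F r s * boundaryCoeff F s t = 0 := by
  classical
  by_cases h : ∃ s, boundaryCoeff F r s * boundaryCoeff F s t ≠ 0
  swap
  · push Not at h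
    exact Finset.sum_eq_zero fun s _ => h s
  obtain ⟨s₀, hs₀⟩ := h
  obtain ⟨y, hy, hys⟩ := exists_of_boundaryCoeff_ne_zero (right_ne_zero_of_mul hs₀)
  obtain ⟨x, hx, hxr⟩ := exists_of_boundaryCoeff_ne_zero (left_ne_zero_of_mul hs₀)
  rw [← hys] at hx hxr
  obtain ⟨hne, hxt⟩ := Finset.mem_erase.mp hx
  clear hys hs₀ s₀
  wlog hxy : x < y generalizing x y
  · refine this x hxt y (Finset.mem_erase.mpr ⟨hne.symm, hy⟩) ?_ hne.symm hy
      (lt_of_le_of_ne (not_lt.mp hxy) hne.symm)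
    rw [Finset.erase_right_comm, hxr]
  have hr : (t.1.erase x).erase y = r.1 := by rw [Finset.erase_right_comm, hxr]
  have hyx : y ∈ t.1.erase x := Finset.mem_erase.mpr ⟨hne.symm, hy⟩
  let a : Simplex V := ⟨t.1.erase x, y, hyx⟩
  let b : Simplex V := ⟨t.1.erase y, x, hx⟩
  have hab : a ≠ b := fun h => by
    have h1 : t.1.erase x = t.1.erase y := congrArg Subtype.val h
    exact Finset.notMem_erase x t.1 (h1 ▸ hx)
  rw [Finset.sum_eq_add_of_mem a b (Finset.mem_univ _) (Finset.mem_univ _) hab]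
  · rw [boundaryCoeff_erase (s := r) (t := a) hyx hr, boundaryCoeff_erase (s := a) hxt rfl,
      boundaryCoeff_erase (s := r) (t := b) hx hxr, boundaryCoeff_erase (s := b) hy rfl,
      ← card_filter_erase_add_one hxt hxy]
    change _ + (-1) ^ ((t.1.erase y).filter (· < x)).card * _ = _
    rw [card_filter_erase_of_lt hxy]
    ring
  · rintro s - ⟨hsa, hsb⟩
    by_contra hs
    obtain ⟨z, hz, hzs⟩ := exists_of_boundaryCoeff_ne_zero (right_ne_zero_of_mul hs)
    obtain ⟨w, hw, hwr⟩ := exists_of_boundaryCoeff_ne_zero (left_ne_zero_of_mul hs)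
    have hzr : z ∉ r.1 := fun h => by
      rw [← hwr, ← hzs] at h
      simp at h
    rw [← hxr] at hzr
    have : z = x ∨ z = y := by
      by_contra hcon
      push Not at hcon
      exact hzr (by simp [hcon, hz])
    rcases this with rfl | rfl
    · exact hsa (Subtype.ext hzs.symm)
    · exact hsb (Subtype.ext hzs.symm)

theorem chainBoundary_chainBoundary (c : Simplex V → F) :
    chainBoundary (chainBoundary c) = 0 := by
  ext r
  simp only [chainBoundary, Finset.mul_sum]
  rw [Finset.sum_comm]
  refine Finset.sum_eq_zero fun t _ => ?_
  simp only [← mul_assoc]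
  rw [← Finset.sum_mul, sum_boundaryCoeff_mul_boundaryCoeff, zero_mul]

theorem chainBoundary_single (t : Simplex V) (a : F) (s : Simplex V) :
    chainBoundary (Pi.single t a) s = boundaryCoeff F s t * a := by
  rw [chainBoundary, Finset.sum_eq_single t, Pi.single_eq_same]
  · intro u _ hu
    rw [Pi.single_eq_of_ne hu, mul_zero]
  · simp

theorem chainBoundary_add (c c' : Simplex V → F) :
    chainBoundary (c + c') = chainBoundary c + chainBoundary c' := by
  ext s
  simp [chainBoundary, mul_add, Finset.sum_add_distrib]

theorem chainBoundary_sub (c c' : Simplex V → F) :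
    chainBoundary (c - c') = chainBoundary c - chainBoundary c' := by
  ext s
  simp [chainBoundary, mul_sub, Finset.sum_sub_distrib]

/-! ### The reduced boundary matrix in terms of chains -/

variable (F) in
/-- The reduced boundary matrix of the Vietoris–Rips filtration. -/
noncomputable abbrev reducedMatrix (T : TieBreak V) (d : V → V → ℝ) :
    Matrix (Fin (Fintype.card (Simplex V))) (Fin (Fintype.card (Simplex V))) F :=
  standardReduction (boundaryMatrix F T d)

theorem boundaryMatrix_mulVec (T : TieBreak V) (d : V → V → ℝ) (c : Simplex V → F)
    (i : Fin (Fintype.card (Simplex V))) :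
    (boundaryMatrix F T d).mulVec (fun l => c (filtrationEnum T d l)) i =
      chainBoundary c (filtrationEnum T d i) :=
  (filtrationEnum T d).sum_comp fun t => boundaryCoeff F (filtrationEnum T d i) t * c t

theorem filtrationKey_enum_le_iff (T : TieBreak V) (d : V → V → ℝ)
    (i j : Fin (Fintype.card (Simplex V))) :
    filtrationKey T d (filtrationEnum T d i) ≤ filtrationKey T d (filtrationEnum T d j) ↔
      i ≤ j := by
  rw [← not_lt, ← not_lt]
  exact not_congr (enumByKey_lt_iff _ _ j i)

/-- A chain on the simplices up to `s`. -/
def SupportedUpTo (T : TieBreak V) (d : V → V → ℝ) (s : Simplex V) (c : Simplex V → F) : Prop :=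
  ∀ t, c t ≠ 0 → filtrationKey T d t ≤ filtrationKey T d s

/-- A chain whose last simplex in the filtration order is `s`. -/
def IsLeading (T : TieBreak V) (d : V → V → ℝ) (s : Simplex V) (c : Simplex V → F) : Prop :=
  c s ≠ 0 ∧ SupportedUpTo T d s c

theorem supportedUpTo_enum_iff (T : TieBreak V) (d : V → V → ℝ) (c : Simplex V → F)
    (i : Fin (Fintype.card (Simplex V))) :
    SupportedUpTo T d (filtrationEnum T d i) c ↔
      ∀ l, c (filtrationEnum T d l) ≠ 0 → l ≤ i := by
  unfold SupportedUpTo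
  rw [(filtrationEnum T d).surjective.forall]
  simp only [filtrationKey_enum_le_iff]

theorem low_reducedMatrix_eq_bot_iff (T : TieBreak V) (d : V → V → ℝ)
    (i : Fin (Fintype.card (Simplex V))) :
    low (reducedMatrix F T d) i = ⊥ ↔
      ∃ c : Simplex V → F, IsLeading T d (filtrationEnum T d i) c ∧ chainBoundary c = 0 := by
  rw [low_standardReduction_eq_bot_iff]
  constructor
  · rintro ⟨c, h1, h2, h3⟩
    obtain ⟨c, rfl⟩ : ∃ c' : Simplex V → F, c = fun l => c' (filtrationEnum T d l) :=
      ⟨fun t => c ((filtrationEnum T d).symm t), by simp⟩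
    refine ⟨c, ⟨h1, (supportedUpTo_enum_iff T d c i).mpr h2⟩, funext fun s => ?_⟩
    obtain ⟨r, rfl⟩ := (filtrationEnum T d).surjective s
    rw [← boundaryMatrix_mulVec, h3]
    rfl
  · rintro ⟨c, ⟨h1, h2⟩, h3⟩
    refine ⟨_, h1, (supportedUpTo_enum_iff T d c i).mp h2, funext fun r => ?_⟩
    rw [boundaryMatrix_mulVec, h3]
    rfl

theorem exists_low_reducedMatrix_eq (T : TieBreak V) (d : V → V → ℝ)
    {i : Fin (Fintype.card (Simplex V))} {c : Simplex V → F}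
    (h : IsLeading T d (filtrationEnum T d i) (chainBoundary c)) :
    ∃ (j : Fin (Fintype.card (Simplex V))) (t : Simplex V),
      low (reducedMatrix F T d) j = (i : WithBot (Fin _)) ∧ c t ≠ 0 ∧
      filtrationKey T d (filtrationEnum T d j) ≤ filtrationKey T d t := by
  obtain ⟨h1, h2⟩ := h
  rw [supportedUpTo_enum_iff] at h2
  simp only [← boundaryMatrix_mulVec] at h1 h2
  obtain ⟨j, l, h3, h4, h5⟩ := exists_low_standardReduction_eq _ h1 h2
  exact ⟨j, _, h3, h4, (filtrationKey_enum_le_iff T d j l).mpr h5⟩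

theorem exists_chain_of_low_reducedMatrix_eq (T : TieBreak V) (d : V → V → ℝ)
    {i j : Fin (Fintype.card (Simplex V))}
    (h : low (reducedMatrix F T d) j = (i : WithBot (Fin _))) :
    ∃ c : Simplex V → F, SupportedUpTo T d (filtrationEnum T d j) c ∧
      IsLeading T d (filtrationEnum T d i) (chainBoundary c) := by
  obtain ⟨c, h1, h2, h3⟩ := exists_chain_of_low_standardReduction_eq _ h
  obtain ⟨c, rfl⟩ : ∃ c' : Simplex V → F, c = fun l => c' (filtrationEnum T d l) :=
    ⟨fun t => c ((filtrationEnum T d).symm t), by simp⟩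
  simp only [boundaryMatrix_mulVec] at h2 h3
  exact ⟨c, (supportedUpTo_enum_iff T d c j).mpr h1, h2, (supportedUpTo_enum_iff T d _ i).mpr h3⟩

/-- The simplex of a lowest entry has a zero column. -/
theorem low_eq_bot_of_low_eq (T : TieBreak V) (d : V → V → ℝ)
    {i j : Fin (Fintype.card (Simplex V))}
    (h : low (reducedMatrix F T d) j = (i : WithBot (Fin _))) :
    low (reducedMatrix F T d) i = ⊥ := by
  obtain ⟨c, -, hc⟩ := exists_chain_of_low_reducedMatrix_eq T d h
  exact (low_reducedMatrix_eq_bot_iff T d i).mpr ⟨_, hc, chainBoundary_chainBoundary c⟩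

end Chains

/-! ### Edges and connectivity -/

section Edges

/-- The simplex spanned by two vertices (a single vertex if they coincide). -/
def pairSimplex {V : Type*} [DecidableEq V] (v w : V) : Simplex V :=
  ⟨{v, w}, v, Finset.mem_insert_self v _⟩

/-- The simplex consisting of one vertex. -/
def vertexSimplex {V : Type*} (v : V) : Simplex V :=
  ⟨{v}, Finset.singleton_nonempty v⟩

theorem vertexSimplex_injective {V : Type*} : Function.Injective (vertexSimplex (V := V)) :=
  fun _ _ h => Finset.singleton_injective (congrArg Subtype.val h)

theorem pairSimplex_comm {V : Type*} [DecidableEq V] (v w : V) :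
    pairSimplex v w = pairSimplex w v :=
  Subtype.ext (Finset.pair_comm v w)

theorem exists_eq_pairSimplex_of_card {V : Type*} [DecidableEq V] {s : Simplex V}
    (h : s.1.card = 2) : ∃ v w, v ≠ w ∧ s = pairSimplex v w := by
  obtain ⟨v, w, hvw, hs⟩ := Finset.card_eq_two.mp h
  exact ⟨v, w, hvw, Subtype.ext hs⟩

variable {F : Type*} [Field F] {V : Type*} [LinearOrder V]

open Classical in
/-- The boundary of an edge is, up to sign, the difference of its vertices. -/
theorem exists_boundaryCoeff_pairSimplex {v w : V} (h : v ≠ w) : ∃ ε : F, ε * ε = 1 ∧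
    ∀ r, boundaryCoeff F r (pairSimplex v w) =
      ε * ((if r = vertexSimplex w then 1 else 0) - if r = vertexSimplex v then 1 else 0) := by
  wlog hvw : v < w generalizing v w
  · obtain ⟨ε, h1, h2⟩ := this h.symm (lt_of_le_of_ne (not_lt.mp hvw) h.symm)
    refine ⟨-ε, by rw [neg_mul_neg, h1], fun r => ?_⟩
    rw [pairSimplex_comm, h2]
    ring
  refine ⟨1, one_mul 1, fun r => ?_⟩
  have h1 : ({v, w} : Finset V).erase v = {w} := by
    ext z
    simp only [Finset.mem_erase, Finset.mem_insert, Finset.mem_singleton]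
    grind
  have h2 : ({v, w} : Finset V).erase w = {v} := by
    ext z
    simp only [Finset.mem_erase, Finset.mem_insert, Finset.mem_singleton]
    grind
  have h3 : (({v, w} : Finset V).filter (· < v)).card = 0 := by
    rw [Finset.card_eq_zero, Finset.filter_eq_empty_iff]
    simp [hvw.le]
  have h4 : (({v, w} : Finset V).filter (· < w)).card = 1 := by
    rw [Finset.card_eq_one]
    refine ⟨v, ?_⟩
    ext z
    simp only [Finset.mem_filter, Finset.mem_insert, Finset.mem_singleton]
    grind
  have h5 : ∀ x : V, ({x} : Finset V) = r.1 ↔ r = vertexSimplex x := fun x =>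
    ⟨fun hx => Subtype.ext hx.symm, fun hx => hx ▸ rfl⟩
  have h6 : boundaryCoeff F r (pairSimplex v w) = ∑ x ∈ {v, w},
      if ({v, w} : Finset V).erase x = r.1 then
        (-1 : F) ^ (({v, w} : Finset V).filter (· < x)).card else 0 := rfl
  rw [h6, Finset.sum_pair h]
  simp only [h1, h2, h3, h4, h5]
  split_ifs <;> simp

variable [Fintype V] (T : TieBreak V) (d : V → V → ℝ)

/-- Two vertices are joined by a path of edges that come before the key `K`. -/
def JoinedBelow (K : ℝ ×ₗ ℕ) : V → V → Prop :=
  Relation.ReflTransGen fun x y => filtrationKey T d (pairSimplex x y) < K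

variable {T d}

/-- Let `g` be the indicator of the vertices joined to `v` by earlier edges. Its coboundary vanishes
on every earlier edge, so pairing it with the cycle leaves only the term of `vw`. If `w` were not
joined to `v`, this term would be nonzero, whereas the pairing equals that of `g` with the zero
boundary. -/
theorem joinedBelow_of_isLeading_cycle {v w : V} (h : v ≠ w) {c : Simplex V → F}
    (hc : IsLeading T d (pairSimplex v w) c) (h0 : chainBoundary c = 0) :
    JoinedBelow T d (filtrationKey T d (pairSimplex v w)) v w := by
  classical
  by_contra hnot
  let K := filtrationKey T d (pairSimplex v w)
  let g : V → F := fun x => if JoinedBelow T d K v x then 1 else 0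
  -- The coboundary of `g`.
  let φ : Simplex V → F := fun t => ∑ x, g x * boundaryCoeff F (vertexSimplex x) t
  have hφ : ∀ x y, x ≠ y → ∃ ε : F, ε ≠ 0 ∧ φ (pairSimplex x y) = ε * (g y - g x) := by
    intro x y hxy
    obtain ⟨ε, h1, h2⟩ := exists_boundaryCoeff_pairSimplex (F := F) hxy
    refine ⟨ε, left_ne_zero_of_mul_eq_one h1, ?_⟩
    simp only [φ, h2, vertexSimplex_injective.eq_iff, mul_sub, Finset.sum_sub_distrib]
    simp [mul_comm]
  have hsum : ∑ t, φ t * c t = 0 := by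
    have h1 : ∑ t, φ t * c t = ∑ x, g x * chainBoundary c (vertexSimplex x) := by
      simp only [φ, chainBoundary, Finset.sum_mul, Finset.mul_sum, mul_assoc]
      exact Finset.sum_comm
    rw [h1, h0]
    simp
  rw [Finset.sum_eq_single_of_mem _ (Finset.mem_univ (pairSimplex v w))] at hsum
  · obtain ⟨ε, h1, h2⟩ := hφ v w h
    have hv : g v = 1 := if_pos Relation.ReflTransGen.refl
    have hw : g w = 0 := if_neg hnot
    rw [h2, hv, hw] at hsum
    simp [h1, hc.1] at hsum
  · intro t _ ht
    by_contra hne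
    have hcard : t.1.card = 2 := by
      obtain ⟨x, -, hx⟩ := Finset.exists_ne_zero_of_sum_ne_zero (left_ne_zero_of_mul hne)
      exact card_of_boundaryCoeff_ne_zero (right_ne_zero_of_mul hx)
    obtain ⟨x, y, hxy, rfl⟩ := exists_eq_pairSimplex_of_card hcard
    have hlt : filtrationKey T d (pairSimplex x y) < K :=
      lt_of_le_of_ne (hc.2 _ (right_ne_zero_of_mul hne))
        fun h => ht (filtrationKey_injective T d h)
    obtain ⟨ε, -, h2⟩ := hφ x y hxy
    have hg : g y = g x := by
      refine if_congr ⟨fun hy => hy.tail ?_, fun hx => hx.tail hlt⟩ rfl rfl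
      rwa [pairSimplex_comm]
    rw [h2, hg] at hne
    simp at hne

-- The signed edges of a path have a telescoping boundary.
open Classical in
theorem exists_chain_of_joinedBelow {K : ℝ ×ₗ ℕ} {v w : V} (h : JoinedBelow T d K v w) :
    ∃ c : Simplex V → F, (∀ t, c t ≠ 0 → filtrationKey T d t < K) ∧ ∀ r, chainBoundary c r =
      (if r = vertexSimplex w then 1 else 0) - if r = vertexSimplex v then 1 else 0 := by
  induction h with
  | refl => exact ⟨0, by simp, by simp [chainBoundary]⟩
  | @tail x y _ hxy ih =>
    obtain ⟨c, h1, h2⟩ := ih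
    -- A step that stays at one vertex gives a vertex simplex rather than an edge and is dropped.
    by_cases hne : x = y
    · exact ⟨c, h1, hne ▸ h2⟩
    obtain ⟨ε, h3, h4⟩ := exists_boundaryCoeff_pairSimplex (F := F) hne
    refine ⟨c + Pi.single (pairSimplex x y) ε, fun t ht => ?_, fun r => ?_⟩
    · by_cases hct : c t = 0
      · by_cases hxt : t = pairSimplex x y
        · exact hxt ▸ hxy
        · simp [hct, Pi.single_eq_of_ne hxt] at ht
      · exact h1 t hct
    · rw [chainBoundary_add, Pi.add_apply, chainBoundary_single, h2, h4, mul_right_comm, h3]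
      ring

/-- The edge closes the path of earlier edges to a cycle and is its last simplex. -/
theorem exists_cycle_of_joinedBelow {v w : V} (hne : v ≠ w)
    (h : JoinedBelow T d (filtrationKey T d (pairSimplex v w)) v w) :
    ∃ c : Simplex V → F, IsLeading T d (pairSimplex v w) c ∧ chainBoundary c = 0 := by
  classical
  obtain ⟨c, h1, h2⟩ := exists_chain_of_joinedBelow (F := F) h
  obtain ⟨ε, h3, h4⟩ := exists_boundaryCoeff_pairSimplex (F := F) hne
  have hc : c (pairSimplex v w) = 0 := by_contra fun hc => lt_irrefl _ (h1 _ hc)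
  refine ⟨c - Pi.single (pairSimplex v w) ε, ⟨?_, fun t ht => ?_⟩, ?_⟩
  · simp [hc, left_ne_zero_of_mul_eq_one h3]
  · by_cases hct : c t = 0
    · by_cases hxt : t = pairSimplex v w
      · rw [hxt]
      · simp [hct, Pi.single_eq_of_ne hxt] at ht
    · exact (h1 t hct).le
  · ext r
    rw [chainBoundary_sub, Pi.sub_apply, chainBoundary_single, h2, h4, mul_right_comm, h3]
    simp

/-- An edge has a zero column in the reduced matrix exactly when its end points are joined by
earlier edges. -/
theorem low_eq_bot_iff_joinedBelow {i : Fin (Fintype.card (Simplex V))} {v w : V} (hne : v ≠ w)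
    (hi : filtrationEnum T d i = pairSimplex v w) :
    low (reducedMatrix F T d) i = ⊥ ↔
      JoinedBelow T d (filtrationKey T d (pairSimplex v w)) v w := by
  rw [low_reducedMatrix_eq_bot_iff, hi]
  exact ⟨fun ⟨_, h1, h2⟩ => joinedBelow_of_isLeading_cycle hne h1 h2,
    exists_cycle_of_joinedBelow hne⟩

end Edges

/-! ### Comparison of Vietoris–Rips barcodes -/

section Comparison

/-- A symmetric nonnegative function that vanishes on the diagonal. -/
structure IsDissimilarity {V : Type*} (d : V → V → ℝ) : Prop where
  self : ∀ v, d v v = 0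
  symm : ∀ v w, d v w = d w v
  nonneg : ∀ v w, 0 ≤ d v w

/-- `d'` dominates `d`, and where they differ there is a third vertex that is closer to both. -/
structure Refines {V : Type*} (d d' : V → V → ℝ) : Prop where
  le : ∀ v w, d v w ≤ d' v w
  eq_or_exists : ∀ v w, v ≠ w → d' v w = d v w ∨
    ∃ u, u ≠ v ∧ u ≠ w ∧ d v u < d v w ∧ d u w < d v w

theorem ripsValue_le_iff {V : Type*} {d : V → V → ℝ} {s : Simplex V} {a : ℝ} :
    ripsValue d s ≤ a ↔ ∀ x ∈ s.1, ∀ y ∈ s.1, d x y ≤ a := by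
  unfold ripsValue
  rw [Finset.sup'_le_iff]
  simp only [Finset.mem_product, Prod.forall]
  exact ⟨fun h x hx y hy => h x y ⟨hx, hy⟩, fun h x y hxy => h x hxy.1 y hxy.2⟩

theorem ripsValue_lt_iff {V : Type*} {d : V → V → ℝ} {s : Simplex V} {a : ℝ} :
    ripsValue d s < a ↔ ∀ x ∈ s.1, ∀ y ∈ s.1, d x y < a := by
  unfold ripsValue
  rw [Finset.sup'_lt_iff]
  simp only [Finset.mem_product, Prod.forall]
  exact ⟨fun h x hx y hy => h x y ⟨hx, hy⟩, fun h x y hxy => h x hxy.1 y hxy.2⟩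

theorem Refines.ripsValue_le {V : Type*} {d d' : V → V → ℝ} (h : Refines d d') (s : Simplex V) :
    ripsValue d s ≤ ripsValue d' s :=
  ripsValue_le_iff.mpr fun x hx y hy => (h.le x y).trans (ripsValue_le_iff.mp le_rfl x hx y hy)

variable {V : Type*} [LinearOrder V] {d d' : V → V → ℝ}

theorem IsDissimilarity.ripsValue_pairSimplex (hd : IsDissimilarity d) (v w : V) :
    ripsValue d (pairSimplex v w) = d v w := by
  refine le_antisymm (ripsValue_le_iff.mpr fun x hx y hy => ?_)
    (ripsValue_le_iff.mp le_rfl v (by simp [pairSimplex]) w (by simp [pairSimplex]))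
  simp only [pairSimplex, Finset.mem_insert, Finset.mem_singleton] at hx hy
  have h1 := hd.symm w v
  have h2 := hd.nonneg v w
  rcases hx with rfl | rfl <;> rcases hy with rfl | rfl <;> simp_all [hd.self]

theorem filtrationKey_lt_iff {V : Type*} {T : TieBreak V} {d : V → V → ℝ} {s t : Simplex V} :
    filtrationKey T d s < filtrationKey T d t ↔ ripsValue d s < ripsValue d t ∨
      ripsValue d s = ripsValue d t ∧ T.rank s < T.rank t :=
  Prod.Lex.toLex_lt_toLex

theorem filtrationKey_le_iff {V : Type*} {T : TieBreak V} {d : V → V → ℝ} {s t : Simplex V} :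
    filtrationKey T d s ≤ filtrationKey T d t ↔ ripsValue d s < ripsValue d t ∨
      ripsValue d s = ripsValue d t ∧ T.rank s ≤ T.rank t :=
  Prod.Lex.toLex_le_toLex

theorem ripsValue_le_of_filtrationKey_le {V : Type*} {T : TieBreak V} {d : V → V → ℝ}
    {s t : Simplex V} (h : filtrationKey T d s ≤ filtrationKey T d t) :
    ripsValue d s ≤ ripsValue d t := by
  rcases filtrationKey_le_iff.mp h with h | h
  · exact h.le
  · exact h.1.le

/-- Passing to a smaller distance keeps the simplices before `s` if `s` keeps its value. -/
theorem Refines.filtrationKey_le {V : Type*} {d d' : V → V → ℝ} {T : TieBreak V}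
    (h : Refines d d') {s t : Simplex V}
    (hs : ripsValue d' s = ripsValue d s) (ht : filtrationKey T d' t ≤ filtrationKey T d' s) :
    filtrationKey T d t ≤ filtrationKey T d s := by
  have h1 := h.ripsValue_le t
  rw [filtrationKey_le_iff] at ht ⊢
  rw [hs] at ht
  rcases ht with ht | ⟨h2, h3⟩
  · exact Or.inl (h1.trans_lt ht)
  · rcases h1.lt_or_eq with h4 | h4
    · exact Or.inl (h4.trans_eq h2)
    · exact Or.inr ⟨h4.trans h2, h3⟩

variable [Fintype V]

/-- An edge whose value changes is replaced by a detour through the vertex `u` of `Refines`, again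
and again; the process stops because `d` strictly decreases on a finite set of pairs. -/
theorem Refines.joinedBelow {T : TieBreak V} (h : Refines d d') (hd : IsDissimilarity d)
    (hd' : IsDissimilarity d') {s : Simplex V} (hs : ripsValue d' s = ripsValue d s) {v w : V}
    (hvw : JoinedBelow T d (filtrationKey T d s) v w) :
    JoinedBelow T d' (filtrationKey T d' s) v w := by
  have close : ∀ p : V × V, d p.1 p.2 < ripsValue d s →
      JoinedBelow T d' (filtrationKey T d' s) p.1 p.2 := by
    have wf : WellFounded fun p q : V × V => d p.1 p.2 < d q.1 q.2 :=
      have : IsTrans (V × V) fun p q => d p.1 p.2 < d q.1 q.2 := ⟨fun _ _ _ => lt_trans⟩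
      have : Std.Irrefl fun p q : V × V => d p.1 p.2 < d q.1 q.2 := ⟨fun _ => lt_irrefl _⟩
      Finite.wellFounded_of_trans_of_irrefl _
    intro p
    induction p using wf.induction with
    | _ p ih =>
      obtain ⟨x, y⟩ := p
      intro hlt
      by_cases hxy : x = y
      · exact hxy ▸ .refl
      rcases h.eq_or_exists x y hxy with he | ⟨u, -, -, h1, h2⟩
      · refine .single (filtrationKey_lt_iff.mpr (Or.inl ?_))
        rwa [hd'.ripsValue_pairSimplex, hs, he]
      · exact (ih (x, u) h1 (h1.trans hlt)).trans (ih (u, y) h2 (h2.trans hlt))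
  induction hvw with
  | refl => exact .refl
  | @tail x y _ hxy ih =>
    refine ih.trans ?_
    by_cases hne : x = y
    · exact hne ▸ .refl
    -- The edge may tie with `s`. If its value is unchanged, the same tie-break applies for `d'`;
    -- otherwise both legs of the detour are strictly below the value of `s`, where `close` applies.
    have hle : d x y ≤ ripsValue d s := by
      rw [← hd.ripsValue_pairSimplex]
      exact ripsValue_le_of_filtrationKey_le hxy.le
    rcases h.eq_or_exists x y hne with he | ⟨u, -, -, h1, h2⟩
    · refine .single ?_
      rw [filtrationKey_lt_iff, hd.ripsValue_pairSimplex] at hxy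
      rwa [filtrationKey_lt_iff, hd'.ripsValue_pairSimplex, hs, he]
    · exact (close (x, u) (h1.trans_le hle)).trans (close (u, y) (h2.trans_le hle))

variable {F : Type*} [Field F]

/-- An edge that is the longest edge of a triangle dies with that triangle at the latest. -/
theorem IsDissimilarity.exists_low_eq_of_triangle (hd : IsDissimilarity d) {T : TieBreak V}
    {v w u : V} (huv : u ≠ v) (huw : u ≠ w) (hvu : d v u < d v w) (hwu : d u w < d v w)
    {i : Fin (Fintype.card (Simplex V))} (hi : filtrationEnum T d i = pairSimplex v w) :
    ∃ j, low (reducedMatrix F T d) j = (i : WithBot (Fin _)) ∧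
      ripsValue d (filtrationEnum T d j) ≤ ripsValue d (filtrationEnum T d i) := by
  classical
  let t : Simplex V := ⟨{u, v, w}, u, by simp⟩
  have hpos : 0 < d v w := (hd.nonneg v u).trans_lt hvu
  have hval : ripsValue d (pairSimplex v w) = d v w := hd.ripsValue_pairSimplex v w
  have hface : boundaryCoeff F (pairSimplex v w) t ≠ 0 := by
    refine boundaryCoeff_erase_ne_zero (v := u) (by simp [t]) ?_
    simp [t, pairSimplex, huv, huw]
  -- The two other edges of the triangle have strictly smaller value than `vw`, so `vw` is its last
  -- face whatever the tie-break.
  have hlead : IsLeading T d (filtrationEnum T d i)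
      (chainBoundary (Pi.single t (1 : F))) := by
    rw [hi]
    refine ⟨by rwa [chainBoundary_single, mul_one], fun r hr => ?_⟩
    rw [chainBoundary_single, mul_one] at hr
    by_cases hrp : r = pairSimplex v w
    · rw [hrp]
    obtain ⟨x, hx, hxr⟩ := exists_of_boundaryCoeff_ne_zero hr
    refine (filtrationKey_lt_iff.mpr (Or.inl ?_)).le
    rw [hval, ripsValue_lt_iff, ← hxr]
    have hxu : x ≠ u := by
      rintro rfl
      refine hrp (Subtype.ext (hxr.symm.trans ?_))
      simp [t, pairSimplex, huv, huw]
    have h1 := hd.symm u v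
    have h2 := hd.symm w u
    simp only [t, Finset.mem_insert, Finset.mem_singleton] at hx
    intro a ha b hb
    simp only [t, Finset.mem_erase, Finset.mem_insert, Finset.mem_singleton] at ha hb
    obtain ⟨ha1, ha⟩ := ha
    obtain ⟨hb1, hb⟩ := hb
    rcases hx with rfl | rfl | rfl
    · exact absurd rfl hxu
    · rcases ha with rfl | rfl | rfl <;> rcases hb with rfl | rfl | rfl <;>
        simp_all [hd.self]
    · rcases ha with rfl | rfl | rfl <;> rcases hb with rfl | rfl | rfl <;>
        simp_all [hd.self]
  obtain ⟨j, t', h1, h2, h3⟩ := exists_low_reducedMatrix_eq T d hlead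
  refine ⟨j, h1, (ripsValue_le_of_filtrationKey_le h3).trans ?_⟩
  obtain rfl : t' = t := by_contra fun h => h2 (Pi.single_eq_of_ne h 1)
  have h4 := hd.symm u v
  have h5 := hd.symm w u
  have h6 := hd.symm w v
  rw [hi, hval, ripsValue_le_iff]
  intro a ha b hb
  simp only [t, Finset.mem_insert, Finset.mem_singleton] at ha hb
  rcases ha with rfl | rfl | rfl <;> rcases hb with rfl | rfl | rfl <;>
    simp_all [hd.self, le_of_lt]

/-- If a simplex keeps its value and is a lowest entry for `d'`, then it is one for `d`, and it
dies no later there. -/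
theorem Refines.exists_low_eq {T : TieBreak V} (h : Refines d d')
    {i i' j' : Fin (Fintype.card (Simplex V))}
    (hii' : filtrationEnum T d' i' = filtrationEnum T d i)
    (hval : ripsValue d' (filtrationEnum T d i) = ripsValue d (filtrationEnum T d i))
    (hlow : low (reducedMatrix F T d') j' = (i' : WithBot (Fin _))) :
    ∃ j, low (reducedMatrix F T d) j = (i : WithBot (Fin _)) ∧
      ripsValue d (filtrationEnum T d j) ≤ ripsValue d' (filtrationEnum T d' j') := by
  obtain ⟨c, hc, h1, h2⟩ := exists_chain_of_low_reducedMatrix_eq T d' hlow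
  rw [hii'] at h1 h2
  -- The boundary operator does not depend on the distance, so the chain `c` serves for both orders.
  obtain ⟨j, t, h3, h4, h5⟩ := exists_low_reducedMatrix_eq (F := F) T d (i := i) (c := c)
    ⟨h1, fun t ht => h.filtrationKey_le hval (h2 t ht)⟩
  refine ⟨j, h3, (ripsValue_le_of_filtrationKey_le h5).trans ((h.ripsValue_le t).trans ?_)⟩
  exact ripsValue_le_of_filtrationKey_le (hc t h4)

theorem Refines.exists_bar {T : TieBreak V} (h : Refines d d') (hd : IsDissimilarity d)
    (hd' : IsDissimilarity d') {B : Bar V} (hB : B ∈ barcodeSet F T 1 d) :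
    ∃ B' ∈ barcodeSet F T 1 d', B'.simplex = B.simplex ∧ B'.birth = B.birth ∧
      B.death ≤ B'.death := by
  -- Both kinds of bar at once: any column paired with `i` gives the death `b`, strictly after the
  -- birth; for an infinite bar this is vacuous.
  obtain ⟨i, b, hcard, hbot, hdeath, rfl⟩ : ∃ (i : Fin (Fintype.card (Simplex V)))
      (b : WithTop ℝ), (filtrationEnum T d i).1.card = 2 ∧ low (reducedMatrix F T d) i = ⊥ ∧
      (∀ j, low (reducedMatrix F T d) j = (i : WithBot (Fin _)) →
        b = (ripsValue d (filtrationEnum T d j) : WithTop ℝ) ∧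
        ripsValue d (filtrationEnum T d i) < ripsValue d (filtrationEnum T d j)) ∧
      B = ⟨ripsValue d (filtrationEnum T d i), b, filtrationEnum T d i⟩ := by
    rcases hB with ⟨i, j, h1, h2, h3, h4⟩ | ⟨i, h1, h2, h3, h4⟩
    · refine ⟨i, _, h1, low_eq_bot_of_low_eq T d h2, fun k hk => ?_, h4⟩
      rw [low_standardReduction_injective _ hk h2]
      exact ⟨rfl, h3⟩
    · exact ⟨i, _, h1, h2, fun k hk => absurd hk (h3 k), h4⟩
  obtain ⟨v, w, hvw, hi⟩ := exists_eq_pairSimplex_of_card hcard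
  -- A changed value would come with a triangle that kills the edge at its birth value, against the
  -- positive length in `hdeath`.
  have hval : ripsValue d' (filtrationEnum T d i) = ripsValue d (filtrationEnum T d i) := by
    rcases h.eq_or_exists v w hvw with he | ⟨u, h1, h2, h3, h4⟩
    · rw [hi, hd.ripsValue_pairSimplex, hd'.ripsValue_pairSimplex, he]
    · obtain ⟨j, hj, hle⟩ := hd.exists_low_eq_of_triangle (F := F) h1 h2 h3 h4 hi
      exact absurd (hdeath j hj).2 hle.not_gt
  obtain ⟨i', hi'⟩ := (filtrationEnum T d').surjective (filtrationEnum T d i)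
  by_cases hex : ∃ j', low (reducedMatrix F T d') j' = (i' : WithBot (Fin _))
  · obtain ⟨j', hj'⟩ := hex
    obtain ⟨j, hj, hle⟩ := h.exists_low_eq hi' hval hj'
    obtain ⟨rfl, hlt⟩ := hdeath j hj
    refine ⟨_, Or.inl ⟨i', j', by rwa [hi'], hj', ?_, rfl⟩, hi', ?_, WithTop.coe_le_coe.mpr hle⟩
    · rw [hi', hval]
      exact hlt.trans_le hle
    · rw [hi', hval]
  · push Not at hex
    refine ⟨_, Or.inr ⟨i', by rwa [hi'], ?_, hex, rfl⟩, hi', ?_, le_top⟩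
    · rw [low_eq_bot_iff_joinedBelow hvw hi] at hbot
      refine (low_eq_bot_iff_joinedBelow hvw (hi'.trans hi)).mpr ?_
      exact h.joinedBelow hd hd' (hi ▸ hval) hbot
    · rw [hi', hval]

/-- A row is the lowest entry of at most one column, and an infinite bar requires that it be the
lowest entry of none. -/
theorem barcodeSet_injOn_simplex (T : TieBreak V) (d : V → V → ℝ) (p : ℕ) :
    Set.InjOn Bar.simplex (barcodeSet F T p d) := by
  intro B hB B' hB' hs
  rcases hB with ⟨i, j, -, h2, -, rfl⟩ | ⟨i, -, -, h3, rfl⟩ <;>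
    rcases hB' with ⟨i', j', -, h2', -, rfl⟩ | ⟨i', -, -, h3', rfl⟩ <;>
    obtain rfl := (filtrationEnum T d).injective hs
  · rw [low_standardReduction_injective _ h2 h2']
  · exact absurd h2 (h3' j)
  · exact absurd h2' (h3 j')
  · rfl

theorem Refines.exists_injection {T : TieBreak V} (h : Refines d d') (hd : IsDissimilarity d)
    (hd' : IsDissimilarity d') :
    ∃ φ : barcodeSet F T 1 d → barcodeSet F T 1 d', Function.Injective φ ∧
      ∀ x, (φ x).1.simplex = x.1.simplex ∧ (φ x).1.birth = x.1.birth ∧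
        x.1.death ≤ (φ x).1.death := by
  choose φ hmem hφ using fun x : barcodeSet F T 1 d => h.exists_bar hd hd' x.2
  refine ⟨fun x => ⟨φ x, hmem x⟩, fun x y hxy => Subtype.ext ?_, hφ⟩
  refine barcodeSet_injOn_simplex T d 1 x.2 y.2 ?_
  exact (hφ x).1.symm.trans ((congrArg (fun z => z.1.simplex) hxy).trans (hφ y).1)

end Comparison

/-! ### The path-based distances -/

section PathDistances

variable {V : Type*} {G : SimpleGraph V} {W : Sym2 V → ℝ}

@[simp]
theorem walkWeight_cons {u v w : V} (h : G.Adj u v) (p : G.Walk v w) :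
    walkWeight W (.cons h p) = W s(u, v) + walkWeight W p := by
  simp [walkWeight]

theorem walkWeight_reverse {v w : V} (p : G.Walk v w) :
    walkWeight W p.reverse = walkWeight W p := by
  simp [walkWeight, List.sum_reverse]

theorem walkWeight_nonneg (hW : ∀ e ∈ G.edgeSet, 0 < W e) {v w : V} (p : G.Walk v w) :
    0 ≤ walkWeight W p := by
  refine List.sum_nonneg fun a ha => ?_
  obtain ⟨e, he, rfl⟩ := List.mem_map.mp ha
  exact (hW e (p.edges_subset_edgeSet he)).le

theorem walkWeight_pos (hW : ∀ e ∈ G.edgeSet, 0 < W e) {v w : V} (hvw : v ≠ w)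
    (p : G.Walk v w) : 0 < walkWeight W p := by
  cases p with
  | nil => exact absurd rfl hvw
  | cons h q =>
    rw [walkWeight_cons]
    exact add_pos_of_pos_of_nonneg (hW _ h) (walkWeight_nonneg hW q)

theorem walkWeight_of_length_eq_one {v w : V} {p : G.Walk v w} (hp : p.length = 1) :
    walkWeight W p = W s(v, w) := by
  cases p with
  | nil => simp at hp
  | cons h q =>
    cases q with
    | nil => simp [walkWeight]
    | cons h' q => simp at hp

/-- The minimum of the weights of the paths with a property. -/
noncomputable def minWalkWeight (W : Sym2 V → ℝ) {v w : V} (Q : G.Walk v w → Prop) : ℝ :=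
  ⨅ p : {p : G.Walk v w // Q p}, walkWeight W p.1

theorem minWalkWeight_le (hW : ∀ e ∈ G.edgeSet, 0 < W e) {v w : V} {Q : G.Walk v w → Prop}
    {p : G.Walk v w} (hp : Q p) : minWalkWeight W Q ≤ walkWeight W p := by
  refine ciInf_le ⟨0, ?_⟩ (⟨p, hp⟩ : {p : G.Walk v w // Q p})
  rintro _ ⟨q, rfl⟩
  exact walkWeight_nonneg hW q.1

theorem exists_walkWeight_eq_minWalkWeight [Finite V] {v w : V} {Q : G.Walk v w → Prop}
    (hQ : ∀ p, Q p → p.IsPath) (hne : ∃ p, Q p) :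
    ∃ p, Q p ∧ walkWeight W p = minWalkWeight W Q := by
  classical
  have := Fintype.ofFinite V
  have : Finite {p : G.Walk v w // Q p} :=
    Finite.of_injective (fun p => (⟨p.1, hQ p.1 p.2⟩ : G.Path v w)) fun p q h =>
      Subtype.ext (congrArg (fun r : G.Path v w => r.1) h)
  have : Nonempty {p : G.Walk v w // Q p} := nonempty_subtype.mpr hne
  obtain ⟨p, hp⟩ := exists_eq_ciInf_of_finite (f := fun p : {p : G.Walk v w // Q p} =>
    walkWeight W p.1)
  exact ⟨p.1, p.2, hp⟩

/-- No walk need satisfy `Q`: the real infimum over an empty family is `0`. -/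
theorem minWalkWeight_nonneg (hW : ∀ e ∈ G.edgeSet, 0 < W e) {v w : V}
    (Q : G.Walk v w → Prop) : 0 ≤ minWalkWeight W Q :=
  Real.iInf_nonneg fun p => walkWeight_nonneg hW p.1

theorem minWalkWeight_reverse {v w : V} {Q : G.Walk v w → Prop} {Q' : G.Walk w v → Prop}
    (h : ∀ p, Q' p ↔ Q p.reverse) : minWalkWeight W Q' = minWalkWeight W Q := by
  refine Equiv.iInf_congr (⟨fun p => ⟨p.1.reverse, (h _).mp p.2⟩,
    fun p => ⟨p.1.reverse, (h _).mpr (by simpa using p.2)⟩, fun p => by simp, fun p => by simp⟩ :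
      {p : G.Walk w v // Q' p} ≃ {p : G.Walk v w // Q p}) fun p => ?_
  exact walkWeight_reverse p.1

variable [DecidableEq V]

theorem minWeightDist_eq {v w : V} (h : v ≠ w) :
    minWeightDist G W v w = minWalkWeight W (fun p : G.Walk v w => p.IsPath) :=
  if_neg h

theorem hybridDist_eq {v w : V} (h : v ≠ w) : hybridDist G W v w =
    minWalkWeight W (fun p : G.Walk v w => p.IsPath ∧ p.length = G.dist v w) :=
  if_neg h

theorem minEdgeDist_eq (P : MinimalEdgePaths G) {v w : V} (h : v ≠ w) :
    minEdgeDist P W v w = walkWeight W (P.path v w) :=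
  if_neg h

theorem isDissimilarity_minWeightDist (hW : ∀ e ∈ G.edgeSet, 0 < W e) :
    IsDissimilarity (minWeightDist G W) where
  self v := if_pos rfl
  symm v w := by
    by_cases h : v = w
    · rw [h]
    rw [minWeightDist_eq h, minWeightDist_eq (Ne.symm h)]
    exact minWalkWeight_reverse fun p => by simp
  nonneg v w := by
    by_cases h : v = w
    · simp [minWeightDist, h]
    rw [minWeightDist_eq h]
    exact minWalkWeight_nonneg hW _

theorem isDissimilarity_hybridDist (hW : ∀ e ∈ G.edgeSet, 0 < W e) :
    IsDissimilarity (hybridDist G W) where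
  self v := if_pos rfl
  symm v w := by
    by_cases h : v = w
    · rw [h]
    rw [hybridDist_eq h, hybridDist_eq (Ne.symm h)]
    exact minWalkWeight_reverse fun p => by simp [G.dist_comm (u := v)]
  nonneg v w := by
    by_cases h : v = w
    · simp [hybridDist, h]
    rw [hybridDist_eq h]
    exact minWalkWeight_nonneg hW _

theorem isDissimilarity_minEdgeDist (hW : ∀ e ∈ G.edgeSet, 0 < W e) (P : MinimalEdgePaths G) :
    IsDissimilarity (minEdgeDist P W) where
  self v := if_pos rfl
  symm v w := by
    by_cases h : v = w
    · rw [h]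
    rw [minEdgeDist_eq P h, minEdgeDist_eq P (Ne.symm h), P.symm v w, walkWeight_reverse]
  nonneg v w := by
    by_cases h : v = w
    · simp [minEdgeDist, h]
    rw [minEdgeDist_eq P h]
    exact walkWeight_nonneg hW _

/-- For adjacent vertices every competing path has length one. `P` only supplies a competitor, so
that the infimum is attained. -/
theorem hybridDist_of_adj [Finite V] (P : MinimalEdgePaths G) {v w : V} (h : G.Adj v w) :
    hybridDist G W v w = W s(v, w) := by
  obtain ⟨p, ⟨-, hp⟩, hpw⟩ := exists_walkWeight_eq_minWalkWeight (W := W)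
    (Q := fun p : G.Walk v w => p.IsPath ∧ p.length = G.dist v w) (fun p hp => hp.1)
    ⟨P.path v w, P.isPath v w, P.length_eq v w⟩
  rw [hybridDist_eq h.ne, ← hpw]
  exact walkWeight_of_length_eq_one (hp.trans (SimpleGraph.dist_eq_one_iff_adj.mpr h))

theorem minEdgeDist_of_adj (P : MinimalEdgePaths G) {v w : V} (h : G.Adj v w) :
    minEdgeDist P W v w = W s(v, w) := by
  rw [minEdgeDist_eq P h.ne]
  exact walkWeight_of_length_eq_one
    ((P.length_eq v w).trans (SimpleGraph.dist_eq_one_iff_adj.mpr h))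

theorem minWeightDist_le (hW : ∀ e ∈ G.edgeSet, 0 < W e) {v w : V} (h : v ≠ w) {p : G.Walk v w}
    (hp : p.IsPath) : minWeightDist G W v w ≤ walkWeight W p := by
  rw [minWeightDist_eq h]
  exact minWalkWeight_le hW hp

theorem hybridDist_le (hW : ∀ e ∈ G.edgeSet, 0 < W e) {v w : V} (h : v ≠ w) {p : G.Walk v w}
    (hp : p.length = G.dist v w) : hybridDist G W v w ≤ walkWeight W p := by
  rw [hybridDist_eq h]
  exact minWalkWeight_le hW ⟨p.isPath_of_length_eq_dist hp, hp⟩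

/-- Cut a lightest path after its first edge. If nothing remains, that edge gives both distances;
otherwise both pieces have positive weight, so each is lighter than the whole. -/
theorem refines_minWeightDist_hybridDist [Finite V] (hW : ∀ e ∈ G.edgeSet, 0 < W e)
    (P : MinimalEdgePaths G) : Refines (minWeightDist G W) (hybridDist G W) where
  le v w := by
    by_cases h : v = w
    · simp [minWeightDist, hybridDist, h]
    obtain ⟨p, hp, hpw⟩ := exists_walkWeight_eq_minWalkWeight (W := W)
      (Q := fun p : G.Walk v w => p.IsPath ∧ p.length = G.dist v w) (fun p hp => hp.1)
      ⟨P.path v w, P.isPath v w, P.length_eq v w⟩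
    rw [hybridDist_eq h, ← hpw]
    exact minWeightDist_le hW h hp.1
  eq_or_exists v w h := by
    obtain ⟨p, hp, hpw⟩ := exists_walkWeight_eq_minWalkWeight (W := W)
      (Q := fun p : G.Walk v w => p.IsPath) (fun p hp => hp) ⟨P.path v w, P.isPath v w⟩
    rw [← minWeightDist_eq h] at hpw
    cases p with
    | nil => exact absurd rfl h
    | @cons _ u _ hvu q =>
      rw [SimpleGraph.Walk.cons_isPath_iff] at hp
      rw [walkWeight_cons] at hpw
      by_cases huw : u = w
      · subst huw
        left
        rw [hybridDist_of_adj P hvu, ← hpw]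
        have : q = .nil := SimpleGraph.Walk.eq_nil_iff_nil.mpr
          (SimpleGraph.Walk.isPath_iff_nil.mp hp.1)
        simp [this, walkWeight]
      · have h1 : minWeightDist G W v u ≤ W s(v, u) := by
          simpa [walkWeight] using minWeightDist_le hW hvu.ne (p := hvu.toWalk) (by simp [hvu.ne])
        have h2 : minWeightDist G W u w ≤ walkWeight W q := minWeightDist_le hW huw hp.1
        have h3 := walkWeight_pos hW huw q
        have h4 : 0 < W s(v, u) := hW _ hvu
        exact Or.inr ⟨u, hvu.ne', huw, by linarith, by linarith⟩

/-- The same cut, applied to a lightest path among those with the fewest edges. -/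
theorem refines_hybridDist_minEdgeDist [Finite V] (hW : ∀ e ∈ G.edgeSet, 0 < W e)
    (P : MinimalEdgePaths G) : Refines (hybridDist G W) (minEdgeDist P W) where
  le v w := by
    by_cases h : v = w
    · simp [hybridDist, minEdgeDist, h]
    rw [minEdgeDist_eq P h]
    exact hybridDist_le hW h (P.length_eq v w)
  eq_or_exists v w h := by
    by_cases hadj : G.Adj v w
    · exact Or.inl ((minEdgeDist_of_adj P hadj).trans (hybridDist_of_adj P hadj).symm)
    obtain ⟨p, ⟨-, hp⟩, hpw⟩ := exists_walkWeight_eq_minWalkWeight (W := W)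
      (Q := fun p : G.Walk v w => p.IsPath ∧ p.length = G.dist v w) (fun p hp => hp.1)
      ⟨P.path v w, P.isPath v w, P.length_eq v w⟩
    rw [← hybridDist_eq h] at hpw
    cases p with
    | nil => exact absurd rfl h
    | @cons _ u _ hvu q =>
      rw [walkWeight_cons] at hpw
      rw [SimpleGraph.Walk.length_cons] at hp
      have huw : u ≠ w := fun h => hadj (h ▸ hvu)
      -- The tail competes for `hybridDist` only if it has the fewest edges itself; a shorter tail
      -- would shorten the whole path.
      have hq : q.length = G.dist u w := by
        refine le_antisymm ?_ (SimpleGraph.dist_le q)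
        obtain ⟨q', hq'⟩ := q.reachable.exists_walk_length_eq_dist
        have := SimpleGraph.dist_le (q'.cons hvu)
        rw [SimpleGraph.Walk.length_cons] at this
        omega
      have h1 := hybridDist_of_adj (W := W) P hvu
      have h2 := hybridDist_le hW huw hq
      have h3 := walkWeight_pos hW huw q
      have h4 : 0 < W s(v, u) := hW _ hvu
      exact Or.inr ⟨u, hvu.ne', huw, by linarith, by linarith⟩

end PathDistances

/-! ### The two injections -/

theorem mainTheorem1 (F : Type*) [Field F] {V : Type*} [Fintype V] [LinearOrder V]
    (G : SimpleGraph V) (hG : G.Connected)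
    (W : Sym2 V → ℝ) (hW : ∀ e ∈ G.edgeSet, 0 < W e)
    (P : MinimalEdgePaths G) (T : TieBreak V) :
    ∃ (φ₂₃ : barcodeSet F T 1 (minWeightDist G W) → barcodeSet F T 1 (hybridDist G W))
      (φ₃₁ : barcodeSet F T 1 (hybridDist G W) → barcodeSet F T 1 (minEdgeDist P W)),
      Function.Injective φ₂₃ ∧ Function.Injective φ₃₁ ∧
      (∀ x, (φ₂₃ x).1.simplex = x.1.simplex ∧ (φ₂₃ x).1.birth = x.1.birth ∧
        x.1.death ≤ (φ₂₃ x).1.death) ∧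
      (∀ y, (φ₃₁ y).1.simplex = y.1.simplex ∧ (φ₃₁ y).1.birth = y.1.birth ∧
        y.1.death ≤ (φ₃₁ y).1.death) := by
  obtain ⟨φ₂₃, h1, h2⟩ := (refines_minWeightDist_hybridDist hW P).exists_injection (F := F)
    (T := T) (isDissimilarity_minWeightDist hW) (isDissimilarity_hybridDist hW)
  obtain ⟨φ₃₁, h3, h4⟩ := (refines_hybridDist_minEdgeDist hW P).exists_injection (F := F)
    (T := T) (isDissimilarity_hybridDist hW) (isDissimilarity_minEdgeDist hW P)
  exact ⟨φ₂₃, φ₃₁, h1, h3, h2, h4⟩
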